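/- A perfect secret sharing scheme for a (finite or infinite) graph $G=(V,E)$ is a family of jointly distributed discrete random variables, a secret $\xi$ with Shannon entropy $0<H(\xi)<\infty$ and a share $\xi_v$ for each $v\in V$, such that (i) for every edge $vw$ the pair $(\xi_v,\xi_w)$ determines $\xi$ almost surely, and (ii) for every (possibly infinite) independent set $A\subseteq V$ the secret $\xi$ is statistically independent of the collection $(\xi_v)_{v\in A}$. The (worst case) information ratio of the scheme is $\sup_{v\in V} H(\xi_v)/H(\xi)$ and, if $V$ is finite and nonempty, its average information ratio is $\frac1{|V|}\sum_{v\in V}H(\xi_v)/H(\xi)$. The worst case (respectively, for finite $G$, average) information ratio of $G$ is the infimum of this quantity over all perfect secret sharing schemes for $G$. The average information ratio of an infinite graph is the supremum of the average information ratios of its finite nonempty spanned (induced) subgraphs. Let $L^d$ be the graph with vertex set $\mathbb Z^d$ in which two points are adjacent if and only if they differ in exactly one coordinate, and there by exactly $1$, and let $L^d_k$ be its subgraph spanned by $\{0,1,\dots,k-1\}^d$. Theorem. For every $d\ge 2$ the information ratio of $L^d$ is exactly $d$, both in the worst case and in the average sense: the worst case information ratio of $L^d$ equals $d$, the average information ratio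 of $L^d$ equals $d$, and the average information ratio of $L^d_k$ tends to $d$ as $k\to\infty$. -/

import Mathlib

open MeasureTheory ProbabilityTheory Filter Topology
open scoped ENNReal

noncomputable section

/-- Shannon entropy `∑ₓ -P(X = x) log P(X = x)` of a discrete random variable, possibly `∞`.
The base of the logarithm is irrelevant below, since only quotients of entropies occur. -/
def shannonEntropy {Ω S : Type} [MeasurableSpace Ω] (μ : Measure Ω) (X : Ω → S) : ℝ≥0∞ :=
  ∑' x : S, ENNReal.ofReal (Real.negMulLog (μ.real (X ⁻¹' {x})))

/-- A perfect secret sharing scheme for the graph `G`: jointly distributed discrete random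
variables, the secret and one share for every vertex, such that the two shares at the ends of an
edge determine the secret (almost surely) and the shares of any (possibly infinite) independent
set are jointly independent of the secret. The secret has positive finite entropy, so that the
information ratios make sense. -/
structure SecretSharingScheme {V : Type} (G : SimpleGraph V) where
  /-- the sample space -/
  Ω : Type
  [measurableSpaceΩ : MeasurableSpace Ω]
  /-- the probability measure -/
  μ : Measure Ω
  [isProbabilityMeasure : IsProbabilityMeasure μ]
  /-- the set of values of the secret -/
  Secret : Type
  [countableSecret : Countable Secret]
  [measurableSpaceSecret : MeasurableSpace Secret]
  [discreteSecret : DiscreteMeasurableSpace Secret]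
  /-- the set of values of the share of a vertex -/
  Share : V → Type
  [countableShare : ∀ v, Countable (Share v)]
  [measurableSpaceShare : ∀ v, MeasurableSpace (Share v)]
  [discreteShare : ∀ v, DiscreteMeasurableSpace (Share v)]
  /-- the secret -/
  secret : Ω → Secret
  /-- the shares -/
  share : (v : V) → Ω → Share v
  measurable_secret : Measurable secret
  measurable_share : ∀ v, Measurable (share v)
  entropy_secret_pos : 0 < shannonEntropy μ secret
  entropy_secret_lt_top : shannonEntropy μ secret < ∞
  recover : ∀ v w, G.Adj v w →
    ∃ g : Share v → Share w → Secret, ∀ᵐ ω ∂μ, secret ω = g (share v ω) (share w ω)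
  perfect : ∀ A : Set V, G.IsIndepSet A →
    IndepFun secret (fun ω (v : A) => share v.1 ω) μ

namespace SecretSharingScheme

attribute [instance] measurableSpaceΩ isProbabilityMeasure countableSecret measurableSpaceSecret
  discreteSecret countableShare measurableSpaceShare discreteShare

/-- The information ratio of the vertex `v`: entropy of its share over entropy of the secret. -/
def ratio {V : Type} {G : SimpleGraph V} (S : SecretSharingScheme G) (v : V) : ℝ≥0∞ :=
  shannonEntropy S.μ (S.share v) / shannonEntropy S.μ S.secret

/-- The worst case information ratio of a scheme. -/
def worstRatio {V : Type} {G : SimpleGraph V} (S : SecretSharingScheme G) : ℝ≥0∞ :=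
  ⨆ v : V, S.ratio v

/-- The average information ratio of a scheme on a finite graph. -/
def averageRatio {V : Type} [Fintype V] {G : SimpleGraph V} (S : SecretSharingScheme G) :
    ℝ≥0∞ :=
  (∑ v : V, S.ratio v) / (Fintype.card V : ℝ≥0∞)

end SecretSharingScheme

/-- The (worst case) information ratio of a finite or infinite graph. -/
def informationRatio {V : Type} (G : SimpleGraph V) : ℝ≥0∞ :=
  ⨅ S : SecretSharingScheme G, S.worstRatio

/-- The average information ratio of a finite graph. -/
def averageInformationRatio {V : Type} [Fintype V] (G : SimpleGraph V) : ℝ≥0∞ :=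
  ⨅ S : SecretSharingScheme G, S.averageRatio

/-- The average information ratio of the subgraph of `G` spanned by a finite set of vertices. -/
def spannedAverageRatio {V : Type} (G : SimpleGraph V) (W : Finset V) : ℝ≥0∞ :=
  averageInformationRatio (G.induce (W : Set V))

/-- The average information ratio of a possibly infinite graph: the supremum over its finite
nonempty spanned subgraphs. -/
def localAverageInformationRatio {V : Type} (G : SimpleGraph V) : ℝ≥0∞ :=
  ⨆ (W : Finset V) (_ : W.Nonempty), spannedAverageRatio G W

/-- The `d`-dimensional lattice: integer points, two being adjacent when they differ in a single
coordinate, by exactly one. -/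
def latticeGraph (d : ℕ) : SimpleGraph (Fin d → ℤ) where
  Adj x y := ∃ i, |x i - y i| = 1 ∧ ∀ j, j ≠ i → x j = y j
  symm := ⟨by
    rintro x y ⟨i, hi, h⟩
    exact ⟨i, by rwa [abs_sub_comm], fun j hj => (h j hj).symm⟩⟩
  loopless := ⟨by
    rintro x ⟨i, hi, -⟩
    simp at hi⟩

/-- The vertices of the finite lattice box with `k` vertices along each dimension. -/
def latticeBox (d k : ℕ) : Finset (Fin d → ℤ) :=
  Fintype.piFinset fun _ => Finset.Ico (0 : ℤ) (k : ℤ)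

end

/-! Lower bound. The joint entropies of the shares form a polymatroid in which the entropy `h` of
the secret is gained whenever an independent set is enlarged to a dependent one, or two dependent
sets with independent intersection are combined. When a finite set of points is cut along a
hyperplane, every edge crossing the cut therefore contributes `h` to the sum of the entropies of the
shares. Cutting a box repeatedly, until only pairs of neighbors remain, one collects `h` for every
edge, and there are about `d` edges per point.

Upper bound. The unit squares in the planes of any two directions fall into two chessboard classes,
each of which partitions the lattice into 4-cycles, which are complete bipartite graphs. The secret
consists of bits `t 0 = 0, t 1, …, t (d - 1)`, and the bit `t i + t j` is distributed with a
one-time pad on each square in the directions `i` and `j`. The ends of an edge in direction `i`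
share a square with every other direction `j`, hence know all sums `t i + t j` and the secret, of
`d - 1` bits. Every point lies in one square of each of the `d * (d - 1)` classes, so a share has
`d * (d - 1)` bits. -/

section Entropy

variable {Ω S T U : Type} [MeasurableSpace Ω] {μ : Measure Ω}

/-- The probability mass function `x ↦ P(X = x)` of a random variable `X`. It is real-valued, like
the masses in `shannonEntropy`, which it abbreviates. -/
noncomputable def probMass (μ : Measure Ω) (X : Ω → S) (x : S) : ℝ :=
  μ.real (X ⁻¹' {x})

theorem probMass_nonneg (X : Ω → S) (x : S) : 0 ≤ probMass μ X x :=
  measureReal_nonneg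

theorem ofReal_probMass [IsFiniteMeasure μ] (X : Ω → S) (x : S) :
    ENNReal.ofReal (probMass μ X x) = μ (X ⁻¹' {x}) :=
  ofReal_measureReal

theorem neg_log_probMass_nonneg [IsProbabilityMeasure μ] (X : Ω → S) (x : S) :
    0 ≤ -Real.log (probMass μ X x) :=
  neg_nonneg.2 (Real.log_nonpos measureReal_nonneg measureReal_le_one)

theorem probMass_le_probMass_comp [IsFiniteMeasure μ] (X : Ω → S) (g : S → T) (x : S) :
    probMass μ X x ≤ probMass μ (g ∘ X) (g x) :=
  measureReal_mono fun _ hω => congrArg g hω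

theorem ae_probMass_pos [Countable S] [IsFiniteMeasure μ] (X : Ω → S) :
    ∀ᵐ ω ∂μ, 0 < probMass μ X (X ω) := by
  have hnull : μ (⋃ x ∈ {x : S | probMass μ X x = 0}, X ⁻¹' {x}) = 0 :=
    (measure_biUnion_null_iff (Set.to_countable _)).2 fun x hx => (measureReal_eq_zero_iff).1 hx
  refine measure_mono_null (fun ω hω => ?_) hnull
  exact Set.mem_biUnion (le_antisymm (not_lt.1 hω) (probMass_nonneg X (X ω))) rfl

theorem shannonEntropy_congr {X Y : Ω → S} (h : X =ᵐ[μ] Y) :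
    shannonEntropy μ X = shannonEntropy μ Y := by
  refine tsum_congr fun x => congrArg (fun p => ENNReal.ofReal (Real.negMulLog p)) ?_
  exact measureReal_congr (h.preimage {x})

theorem shannonEntropy_of_unique [Unique S] [IsProbabilityMeasure μ] (X : Ω → S) :
    shannonEntropy μ X = 0 := by
  have h : ∀ x : S, X ⁻¹' {x} = Set.univ := fun x =>
    Set.eq_univ_of_forall fun ω => Subsingleton.elim (X ω) x
  simp [shannonEntropy, h]

theorem shannonEntropy_of_uniform [Fintype S] [Nonempty S] {X : Ω → S}
    (h : ∀ x, probMass μ X x = (Fintype.card S : ℝ)⁻¹) :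
    shannonEntropy μ X = ENNReal.ofReal (Real.log (Fintype.card S)) := by
  have hN : (Fintype.card S : ℝ) ≠ 0 := Nat.cast_ne_zero.2 Fintype.card_ne_zero
  unfold probMass at h
  simp only [shannonEntropy, h, tsum_fintype, Finset.sum_const, Finset.card_univ]
  rw [← ENNReal.ofReal_nsmul, nsmul_eq_mul, Real.negMulLog, Real.log_inv, neg_mul_neg,
    mul_inv_cancel_left₀ hN]

variable [Countable S] [MeasurableSpace S] [DiscreteMeasurableSpace S]
  [Countable T] [MeasurableSpace T] [DiscreteMeasurableSpace T]
  [Countable U] [MeasurableSpace U] [DiscreteMeasurableSpace U]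
  [IsProbabilityMeasure μ]

theorem lintegral_comp_eq_tsum {X : Ω → S} (hX : Measurable X) (f : S → ℝ≥0∞) :
    ∫⁻ ω, f (X ω) ∂μ = ∑' x, f x * ENNReal.ofReal (probMass μ X x) := by
  rw [← lintegral_map (measurable_of_countable f) hX, lintegral_countable']
  exact tsum_congr fun x => by
    rw [Measure.map_apply hX (measurableSet_singleton x), ofReal_probMass]

theorem tsum_ofReal_probMass {X : Ω → S} (hX : Measurable X) :
    ∑' x, ENNReal.ofReal (probMass μ X x) = 1 := by
  simpa using (lintegral_comp_eq_tsum (μ := μ) hX fun _ => 1).symm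

theorem tsum_ofReal_probMass_prodMk {X : Ω → S} {Z : Ω → U} (hX : Measurable X)
    (hZ : Measurable Z) (z : U) :
    ∑' x, ENNReal.ofReal (probMass μ (fun ω => (X ω, Z ω)) (x, z)) =
      ENNReal.ofReal (probMass μ Z z) := by
  simp only [ofReal_probMass]
  rw [← measure_iUnion]
  · congr 1
    ext ω
    simp
  · refine fun x y hxy => Set.disjoint_left.2 fun ω hx hy => hxy ?_
    exact congrArg Prod.fst (Eq.trans (Eq.symm hx) hy)
  · exact fun x => (hX.prodMk hZ) (measurableSet_singleton _)

theorem shannonEntropy_eq_lintegral {X : Ω → S} (hX : Measurable X) :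
    shannonEntropy μ X = ∫⁻ ω, ENNReal.ofReal (-Real.log (probMass μ X (X ω))) ∂μ := by
  rw [lintegral_comp_eq_tsum hX fun x => ENNReal.ofReal (-Real.log (probMass μ X x))]
  refine tsum_congr fun x => ?_
  rw [← ENNReal.ofReal_mul' (probMass_nonneg X x), Real.negMulLog, ← probMass, neg_mul_comm,
    mul_comm]

theorem measurable_ofReal_neg_log_comp {X : Ω → S} (hX : Measurable X) (q : S → ℝ) :
    Measurable fun ω => ENNReal.ofReal (-Real.log (q (X ω))) :=
  (measurable_of_countable fun x => ENNReal.ofReal (-Real.log (q x))).comp hX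

/-- The Gibbs inequality: coding `X` according to a wrong (sub)probability `q` costs at least its
entropy. -/
theorem shannonEntropy_le_lintegral_neg_log {X : Ω → S} (hX : Measurable X) {q : S → ℝ}
    (hpos : ∀ᵐ ω ∂μ, 0 < q (X ω)) (hsum : ∑' x, ENNReal.ofReal (q x) ≤ 1) :
    shannonEntropy μ X ≤ ∫⁻ ω, ENNReal.ofReal (-Real.log (q (X ω))) ∂μ := by
  have hratio : ∫⁻ ω, ENNReal.ofReal (q (X ω) / probMass μ X (X ω)) ∂μ ≤ 1 := by
    rw [lintegral_comp_eq_tsum hX fun x => ENNReal.ofReal (q x / probMass μ X x)]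
    refine le_trans (ENNReal.tsum_le_tsum fun x => ?_) hsum
    rw [← ENNReal.ofReal_mul' (probMass_nonneg X x)]
    rcases (probMass_nonneg (μ := μ) X x).eq_or_lt with hp | hp
    · simp [← hp]
    · rw [div_mul_cancel₀ _ hp.ne']
  refine (ENNReal.add_le_add_iff_right ENNReal.one_ne_top).1 ?_
  calc shannonEntropy μ X + 1
      = ∫⁻ ω, (ENNReal.ofReal (-Real.log (probMass μ X (X ω))) + 1) ∂μ := by
        rw [lintegral_add_left (measurable_ofReal_neg_log_comp hX _),
          shannonEntropy_eq_lintegral hX]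
        simp
    _ ≤ ∫⁻ ω, (ENNReal.ofReal (-Real.log (q (X ω))) +
          ENNReal.ofReal (q (X ω) / probMass μ X (X ω))) ∂μ := by
        refine lintegral_mono_ae ?_
        filter_upwards [hpos, ae_probMass_pos X] with ω hq hp
        have hlog := Real.log_le_sub_one_of_pos (div_pos hq hp)
        rw [Real.log_div hq.ne' hp.ne'] at hlog
        rw [← ENNReal.ofReal_one, ← ENNReal.ofReal_add (neg_log_probMass_nonneg X _) zero_le_one]
        exact (ENNReal.ofReal_le_ofReal (by linarith)).trans ENNReal.ofReal_add_le
    _ ≤ ∫⁻ ω, ENNReal.ofReal (-Real.log (q (X ω))) ∂μ + 1 := by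
        rw [lintegral_add_left (measurable_ofReal_neg_log_comp hX _)]
        gcongr

theorem shannonEntropy_le_log_card [Fintype T] [Nonempty T] {X : Ω → T} (hX : Measurable X) :
    shannonEntropy μ X ≤ ENNReal.ofReal (Real.log (Fintype.card T)) := by
  have hN : (0 : ℝ) < Fintype.card T := by exact_mod_cast Fintype.card_pos
  have h := shannonEntropy_le_lintegral_neg_log (μ := μ) hX
    (q := fun _ => (Fintype.card T : ℝ)⁻¹) (by simp [hN])
    (by simp [ENNReal.ofReal_inv_of_pos hN, ENNReal.mul_inv_cancel])
  simpa using h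

theorem shannonEntropy_le_of_ae_eq_comp {X : Ω → S} {Y : Ω → T} (hX : Measurable X) (g : S → T)
    (h : Y =ᵐ[μ] g ∘ X) :
    shannonEntropy μ Y ≤ shannonEntropy μ X := by
  rw [shannonEntropy_congr h, shannonEntropy_eq_lintegral hX,
    shannonEntropy_eq_lintegral ((measurable_of_countable g).comp hX)]
  refine lintegral_mono_ae ?_
  filter_upwards [ae_probMass_pos X] with ω hω
  exact ENNReal.ofReal_le_ofReal
    (neg_le_neg (Real.log_le_log hω (probMass_le_probMass_comp X g (X ω))))

theorem tsum_ofReal_condIndep_le_one {X : Ω → S} {Y : Ω → T} {Z : Ω → U} (hX : Measurable X)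
    (hY : Measurable Y) (hZ : Measurable Z) :
    ∑' p : S × T × U, ENNReal.ofReal (probMass μ (fun ω => (X ω, Z ω)) (p.1, p.2.2) *
      (probMass μ (fun ω => (Y ω, Z ω)) p.2 / probMass μ Z p.2.2)) ≤ 1 := by
  rw [ENNReal.tsum_prod', ENNReal.tsum_comm, ← tsum_ofReal_probMass (μ := μ) (hY.prodMk hZ)]
  refine ENNReal.tsum_le_tsum fun p => ?_
  simp only [ENNReal.ofReal_mul (probMass_nonneg _ _)]
  rw [ENNReal.tsum_mul_right, tsum_ofReal_probMass_prodMk hX hZ,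
    ← ENNReal.ofReal_mul (probMass_nonneg _ _)]
  refine ENNReal.ofReal_le_ofReal ?_
  rcases eq_or_ne (probMass μ Z p.2) 0 with hz | hz
  · simpa [hz] using probMass_nonneg _ _
  · rw [mul_div_cancel₀ _ hz]

/-- The Gibbs inequality, applied to the distribution with the same marginals `(X, Z)` and
`(Y, Z)` for which `X` and `Y` are independent given `Z`. -/
theorem shannonEntropy_submodular {X : Ω → S} {Y : Ω → T} {Z : Ω → U}
    (hX : Measurable X) (hY : Measurable Y) (hZ : Measurable Z) :
    shannonEntropy μ (fun ω => (X ω, Y ω, Z ω)) + shannonEntropy μ Z ≤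
      shannonEntropy μ (fun ω => (X ω, Z ω)) + shannonEntropy μ (fun ω => (Y ω, Z ω)) := by
  have hXYZ := hX.prodMk (hY.prodMk hZ)
  have hXZ := hX.prodMk hZ
  have hYZ := hY.prodMk hZ
  set pXZ := probMass μ fun ω => (X ω, Z ω)
  set pYZ := probMass μ fun ω => (Y ω, Z ω)
  set pZ := probMass μ Z
  have hpos : ∀ᵐ ω ∂μ, 0 < pXZ (X ω, Z ω) ∧ 0 < pYZ (Y ω, Z ω) ∧ 0 < pZ (Z ω) := by
    filter_upwards [ae_probMass_pos fun ω => (X ω, Z ω), ae_probMass_pos fun ω => (Y ω, Z ω),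
      ae_probMass_pos Z] with ω h₁ h₂ h₃ using ⟨h₁, h₂, h₃⟩
  have hGibbs := shannonEntropy_le_lintegral_neg_log hXYZ
    (hpos.mono fun ω h => mul_pos h.1 (div_pos h.2.1 h.2.2))
    (tsum_ofReal_condIndep_le_one (μ := μ) hX hY hZ)
  refine (add_le_add_left hGibbs _).trans ?_
  rw [shannonEntropy_eq_lintegral hZ, shannonEntropy_eq_lintegral hXZ,
    shannonEntropy_eq_lintegral hYZ, ← lintegral_add_right _ (measurable_ofReal_neg_log_comp hZ _),
    ← lintegral_add_right _ (measurable_ofReal_neg_log_comp hYZ _)]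
  refine lintegral_mono_ae (hpos.mono fun ω ⟨h₁, h₂, h₃⟩ => le_of_eq ?_)
  have hYZ_le : pYZ (Y ω, Z ω) ≤ pZ (Z ω) :=
    probMass_le_probMass_comp (fun ω => (Y ω, Z ω)) Prod.snd _
  have hlog : Real.log (pYZ (Y ω, Z ω)) ≤ Real.log (pZ (Z ω)) := Real.log_le_log h₂ hYZ_le
  have hXZ_nonneg : 0 ≤ -Real.log (pXZ (X ω, Z ω)) := neg_log_probMass_nonneg _ _
  rw [← ENNReal.ofReal_add hXZ_nonneg (neg_log_probMass_nonneg _ _),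
    Real.log_mul h₁.ne' (div_pos h₂ h₃).ne', Real.log_div h₂.ne' h₃.ne',
    ← ENNReal.ofReal_add (by linarith) (neg_log_probMass_nonneg _ _)]
  congr 1
  ring

theorem shannonEntropy_add_le_of_ae_eq_comp {R : Type} [Countable R] [MeasurableSpace R]
    [DiscreteMeasurableSpace R] {X : Ω → S} {Y : Ω → T} {Z : Ω → U} {W : Ω → R}
    (hX : Measurable X) (hY : Measurable Y) (hZ : Measurable Z)
    (p : S → U) (hp : Z =ᵐ[μ] p ∘ X) (q : T → U) (hq : Z =ᵐ[μ] q ∘ Y)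
    (r : S × T → R) (hr : W =ᵐ[μ] fun ω => r (X ω, Y ω)) :
    shannonEntropy μ W + shannonEntropy μ Z ≤ shannonEntropy μ X + shannonEntropy μ Y :=
  calc shannonEntropy μ W + shannonEntropy μ Z
      ≤ shannonEntropy μ (fun ω => (X ω, Y ω, Z ω)) + shannonEntropy μ Z := by
        gcongr
        exact shannonEntropy_le_of_ae_eq_comp (hX.prodMk (hY.prodMk hZ))
          (fun t => r (t.1, t.2.1)) hr
    _ ≤ shannonEntropy μ (fun ω => (X ω, Z ω)) + shannonEntropy μ (fun ω => (Y ω, Z ω)) :=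
        shannonEntropy_submodular hX hY hZ
    _ ≤ shannonEntropy μ X + shannonEntropy μ Y := by
        gcongr
        · exact shannonEntropy_le_of_ae_eq_comp hX (fun x => (x, p x))
            (hp.mono fun ω h => Prod.ext rfl h)
        · exact shannonEntropy_le_of_ae_eq_comp hY (fun y => (y, q y))
            (hq.mono fun ω h => Prod.ext rfl h)

theorem shannonEntropy_prodMk_of_indepFun {X : Ω → S} {Y : Ω → T} (hX : Measurable X)
    (hY : Measurable Y) (h : IndepFun X Y μ) :
    shannonEntropy μ (fun ω => (X ω, Y ω)) = shannonEntropy μ X + shannonEntropy μ Y := by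
  have hmul : ∀ x y,
      probMass μ (fun ω => (X ω, Y ω)) (x, y) = probMass μ X x * probMass μ Y y := by
    intro x y
    have hpre : (fun ω => (X ω, Y ω)) ⁻¹' {(x, y)} = X ⁻¹' {x} ∩ Y ⁻¹' {y} := by
      ext ω
      simp
    rw [probMass, hpre, measureReal_def, h.measure_inter_preimage_eq_mul _ _
      (measurableSet_singleton x) (measurableSet_singleton y), ENNReal.toReal_mul]
    rfl
  rw [shannonEntropy_eq_lintegral (hX.prodMk hY), shannonEntropy_eq_lintegral hX,
    shannonEntropy_eq_lintegral hY, ← lintegral_add_left (measurable_ofReal_neg_log_comp hX _)]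
  refine lintegral_congr_ae ?_
  filter_upwards [ae_probMass_pos X, ae_probMass_pos Y] with ω h₁ h₂
  rw [hmul, Real.log_mul h₁.ne' h₂.ne', neg_add,
    ENNReal.ofReal_add (neg_log_probMass_nonneg _ _) (neg_log_probMass_nonneg _ _)]

end Entropy

section Polymatroid

variable {V : Type*} {G : SimpleGraph V}

theorem not_isIndepSet_of_adj {s : Finset V} {a b : V} (ha : a ∈ s) (hb : b ∈ s)
    (hab : G.Adj a b) : ¬ G.IsIndepSet s :=
  fun hs => hs ha hb hab.ne hab

/-- Every vertex of `U` has at most one neighbor in `U'`. -/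
def HasAtMostOneNeighbor (G : SimpleGraph V) (U U' : Finset V) : Prop :=
  ∀ v ∈ U, ∀ w ∈ U', ∀ w' ∈ U', G.Adj v w → G.Adj v w' → w = w'

theorem HasAtMostOneNeighbor.mono {U₁ U₁' U₂ U₂' : Finset V} (hG : HasAtMostOneNeighbor G U₁ U₂)
    (h₁ : U₁' ⊆ U₁) (h₂ : U₂' ⊆ U₂) : HasAtMostOneNeighbor G U₁' U₂' :=
  fun v hv w hw w' hw' => hG v (h₁ hv) w (h₂ hw) w' (h₂ hw')

theorem HasAtMostOneNeighbor.isIndepSet_insert_erase [DecidableEq V] {A B : Finset V} {a b : V}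
    (hBA : HasAtMostOneNeighbor G B A) (hA : G.IsIndepSet A) (hb : b ∈ B) (ha : a ∈ A)
    (hab : G.Adj a b) : G.IsIndepSet (insert b (A.erase a) : Finset V) := by
  have hbw : ∀ w ∈ A.erase a, ¬ G.Adj b w := fun w hw hbw =>
    Finset.ne_of_mem_erase hw (hBA b hb w (Finset.mem_of_mem_erase hw) a ha hbw hab.symm)
  intro v hv w hw hvw hadj
  rcases Finset.mem_insert.1 (Finset.mem_coe.1 hv) with rfl | hvA <;>
    rcases Finset.mem_insert.1 (Finset.mem_coe.1 hw) with rfl | hwA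
  · exact hvw rfl
  · exact hbw w hwA hadj
  · exact hbw v hvA hadj.symm
  · exact hA (Finset.mem_of_mem_erase hvA) (Finset.mem_of_mem_erase hwA) hvw hadj

/-- The vertices of `U` which receive the color `x`. -/
def colorPart (c : G.Coloring Bool) (x : Bool) (U : Finset V) : Finset V :=
  U.filter fun v => c v = x

section ColorPart

variable (c : G.Coloring Bool) (x : Bool)

theorem mem_colorPart {U : Finset V} {v : V} : v ∈ colorPart c x U ↔ v ∈ U ∧ c v = x :=
  Finset.mem_filter

theorem colorPart_subset (U : Finset V) : colorPart c x U ⊆ U :=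
  Finset.filter_subset _ _

theorem isIndepSet_colorPart (U : Finset V) : G.IsIndepSet (colorPart c x U) :=
  fun _ hv _ hw _ hvw => c.valid hvw
    (((mem_colorPart c x).1 hv).2.trans ((mem_colorPart c x).1 hw).2.symm)

theorem exists_adj_mem_colorPart {U : Finset V} (hU : ∀ v ∈ U, ∃ w ∈ U, G.Adj w v) :
    ∀ b ∈ colorPart c (!x) U, ∃ a ∈ colorPart c x U, G.Adj a b := by
  intro b hb
  obtain ⟨hbU, hbx⟩ := (mem_colorPart c _).1 hb
  obtain ⟨a, ha, hab⟩ := hU b hbU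
  refine ⟨a, (mem_colorPart c x).2 ⟨ha, ?_⟩, hab⟩
  have hne := c.valid hab
  rw [hbx] at hne
  exact Bool.ne_not.1 hne

theorem colorPart_union [DecidableEq V] (U₁ U₂ : Finset V) :
    colorPart c x (U₁ ∪ U₂) = colorPart c x U₁ ∪ colorPart c x U₂ :=
  Finset.filter_union _ _ _

end ColorPart

variable [DecidableEq V] {f : Finset V → ℝ} {h : ℝ}

/-- The properties of the joint entropies `f A` of the shares of the finite sets `A` of vertices of
`G` in a perfect secret sharing scheme whose secret has entropy `h`: `f` is a polymatroid, and the
entropy `h` of the secret is gained in addition when monotonicity passes from an independent set to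
a dependent one, and when submodularity combines two dependent sets with independent
intersection. -/
structure IsGraphPolymatroid (G : SimpleGraph V) (f : Finset V → ℝ) (h : ℝ) : Prop where
  empty : f ∅ = 0
  mono : ∀ {A B}, A ⊆ B → f A ≤ f B
  submodular : ∀ A B, f (A ∪ B) + f (A ∩ B) ≤ f A + f B
  strict_mono : ∀ {A B : Finset V}, A ⊆ B → G.IsIndepSet A → ¬ G.IsIndepSet B → f A + h ≤ f B
  strict_submodular : ∀ {A B : Finset V}, ¬ G.IsIndepSet A → ¬ G.IsIndepSet B →
    G.IsIndepSet (A ∩ B : Finset V) → f (A ∪ B) + f (A ∩ B) + h ≤ f A + f B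

/-- The conditional mutual information of `X` and `Y` given `Z`, for a set function `f` in the role
of the entropy. -/
def condMutualInfo (f : Finset V → ℝ) (X Y Z : Finset V) : ℝ :=
  f (X ∪ Z) + f (Y ∪ Z) - f (X ∪ Y ∪ Z) - f Z

theorem condMutualInfo_comm (f : Finset V → ℝ) (X Y Z : Finset V) :
    condMutualInfo f X Y Z = condMutualInfo f Y X Z := by
  rw [condMutualInfo, condMutualInfo, Finset.union_comm X Y]
  ring

theorem condMutualInfo_union_right (f : Finset V → ℝ) (X Y Y' Z : Finset V) :
    condMutualInfo f X (Y ∪ Y') Z = condMutualInfo f X Y Z + condMutualInfo f X Y' (Y ∪ Z) := by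
  simp only [condMutualInfo, Finset.union_assoc, Finset.union_left_comm Y' Y]
  ring

theorem condMutualInfo_empty_union_right (f : Finset V → ℝ) (X Y Y' : Finset V) :
    condMutualInfo f X (Y ∪ Y') ∅ = condMutualInfo f X Y ∅ + condMutualInfo f X Y' Y := by
  rw [condMutualInfo_union_right, Finset.union_empty]

namespace IsGraphPolymatroid

variable (hf : IsGraphPolymatroid G f h)
include hf

theorem nonneg (A : Finset V) : 0 ≤ f A :=
  hf.empty.symm.le.trans (hf.mono A.empty_subset)

theorem condMutualInfo_nonneg (X Y Z : Finset V) : 0 ≤ condMutualInfo f X Y Z := by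
  have hsub := hf.submodular (X ∪ Z) (Y ∪ Z)
  have hmono : f Z ≤ f ((X ∪ Z) ∩ (Y ∪ Z)) :=
    hf.mono (Finset.subset_inter Finset.subset_union_right Finset.subset_union_right)
  rw [← Finset.union_union_distrib_right] at hsub
  rw [condMutualInfo]
  linarith

theorem le_condMutualInfo {X Y Z : Finset V} (hXY : Disjoint X Y)
    (hX : ¬ G.IsIndepSet (X ∪ Z : Finset V)) (hY : ¬ G.IsIndepSet (Y ∪ Z : Finset V))
    (hZ : G.IsIndepSet Z) : h ≤ condMutualInfo f X Y Z := by
  have hinter : (X ∪ Z) ∩ (Y ∪ Z) = Z := by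
    rw [← Finset.inter_union_distrib_right, Finset.disjoint_iff_inter_eq_empty.1 hXY,
      Finset.empty_union]
  have hsub := hf.strict_submodular hX hY (by rwa [hinter])
  rw [hinter, ← Finset.union_union_distrib_right] at hsub
  rw [condMutualInfo]
  linarith

theorem condMutualInfo_singleton_empty_le_sub {A : Finset V} {a b : V} (hA : G.IsIndepSet A)
    (ha : a ∈ A) (hab : G.Adj a b) : condMutualInfo f {b} A ∅ ≤ f {b} - h := by
  have hgain := hf.strict_mono (A := A) (B := {b} ∪ A) Finset.subset_union_right hA
    (not_isIndepSet_of_adj (by simp [ha]) (by simp) hab)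
  simp only [condMutualInfo, Finset.union_empty, hf.empty]
  linarith

theorem condMutualInfo_singleton_empty_le (a : V) (A : Finset V) :
    condMutualInfo f {a} A ∅ ≤ f {a} := by
  have hmono : f A ≤ f ({a} ∪ A) := hf.mono Finset.subset_union_right
  simp only [condMutualInfo, Finset.union_empty, hf.empty]
  linarith

/-- By the chain rule the right-hand side is
`I(b; C | D) + I(a; b | C) + I(a; D | C ∪ {b})`, and both `a` and `D` complete the independent set
`C ∪ {b}` to a dependent one. -/
theorem le_condMutualInfo_add_condMutualInfo {C D : Finset V} {a b y : V} (ha : a ∉ D)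
    (hC : G.IsIndepSet (insert b C : Finset V)) (hab : G.Adj a b) (hy : y ∈ D)
    (hyb : G.Adj y b) :
    h ≤ condMutualInfo f {b} (insert a C) D + condMutualInfo f {a} D C := by
  have hb_chain := condMutualInfo_union_right f {b} C {a} D
  have ha_chain := condMutualInfo_union_right f {a} D {b} C
  have ha_chain' := condMutualInfo_union_right f {a} {b} D C
  have hgain : h ≤ condMutualInfo f {a} D ({b} ∪ C) :=
    hf.le_condMutualInfo (Finset.disjoint_singleton_left.2 ha)
      (not_isIndepSet_of_adj (by simp) (by simp) hab)
      (not_isIndepSet_of_adj (by simp [hy]) (by simp) hyb) hC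
  have hbC := hf.condMutualInfo_nonneg {b} C D
  have hab' := hf.condMutualInfo_nonneg {a} {b} C
  rw [Finset.union_comm C {a}, Finset.union_comm C D, condMutualInfo_comm f {b} {a}] at hb_chain
  rw [Finset.union_comm D {b}] at ha_chain
  rw [Finset.insert_eq]
  linarith

end IsGraphPolymatroid

/-- The sum of the mutual informations of each `b ∈ B` with `A` and of each `a ∈ A` with the rest
of `A`. For a bipartite piece of a graph with color classes `A` and `B` this bounds the sum of the
singletons from below, and it splits well along unions of pieces. -/
def totalInfo (f : Finset V → ℝ) (A B : Finset V) : ℝ :=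
  ∑ b ∈ B, condMutualInfo f {b} A ∅ + ∑ a ∈ A, condMutualInfo f {a} (A.erase a) ∅

/-- The contribution to `totalInfo` of the pair of a piece with first color class `A` and a
disjoint piece with color classes `A'` and `B'`. -/
def crossInfo (f : Finset V → ℝ) (A A' B' : Finset V) : ℝ :=
  ∑ b ∈ B', condMutualInfo f {b} A A' + ∑ a ∈ A, condMutualInfo f {a} A' (A.erase a)

theorem totalInfo_union (f : Finset V → ℝ) {A₁ A₂ B₁ B₂ : Finset V} (hA : Disjoint A₁ A₂)
    (hB : Disjoint B₁ B₂) :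
    totalInfo f (A₁ ∪ A₂) (B₁ ∪ B₂) =
      totalInfo f A₁ B₁ + totalInfo f A₂ B₂ + (crossInfo f A₁ A₂ B₂ + crossInfo f A₂ A₁ B₁) := by
  have herase : ∀ {A A' : Finset V}, Disjoint A A' → ∀ a ∈ A,
      condMutualInfo f {a} ((A ∪ A').erase a) ∅ =
        condMutualInfo f {a} (A.erase a) ∅ + condMutualInfo f {a} A' (A.erase a) := by
    intro A A' hdisj a ha
    rw [Finset.erase_union_distrib,
      Finset.erase_eq_of_notMem (Finset.disjoint_left.1 hdisj ha),
      condMutualInfo_empty_union_right]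
  have hB₁ : ∑ b ∈ B₁, condMutualInfo f {b} (A₁ ∪ A₂) ∅ =
      ∑ b ∈ B₁, (condMutualInfo f {b} A₁ ∅ + condMutualInfo f {b} A₂ A₁) :=
    Finset.sum_congr rfl fun b _ => condMutualInfo_empty_union_right f {b} A₁ A₂
  have hB₂ : ∑ b ∈ B₂, condMutualInfo f {b} (A₁ ∪ A₂) ∅ =
      ∑ b ∈ B₂, (condMutualInfo f {b} A₂ ∅ + condMutualInfo f {b} A₁ A₂) :=
    Finset.sum_congr rfl fun b _ => by
      rw [Finset.union_comm, condMutualInfo_empty_union_right]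
  have hA₂ := Finset.sum_congr rfl (herase hA.symm)
  rw [Finset.union_comm] at hA₂
  simp only [totalInfo, crossInfo, Finset.sum_union hA, Finset.sum_union hB, hB₁, hB₂, hA₂,
    Finset.sum_congr rfl (herase hA), Finset.sum_add_distrib]
  ring

variable [DecidableRel G.Adj]

theorem card_interedges_union {A₁ A₂ B₁ B₂ : Finset V} (hA : Disjoint A₁ A₂)
    (hB : Disjoint B₁ B₂) :
    (G.interedges (A₁ ∪ A₂) (B₁ ∪ B₂)).card =
      (G.interedges A₁ B₁).card + (G.interedges A₂ B₂).card +
        ((G.interedges A₁ B₂).card + (G.interedges A₂ B₁).card) := by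
  simp only [SimpleGraph.interedges_def, Finset.card_filter, Finset.sum_product,
    Finset.sum_union hA, Finset.sum_union hB, Finset.sum_add_distrib]
  ring

theorem mul_card_interedges_le_crossInfo (hf : IsGraphPolymatroid G f h) {A A' B' : Finset V}
    (hdisj : Disjoint A A') (hA : G.IsIndepSet A) (hB' : ∀ b ∈ B', ∃ y ∈ A', G.Adj y b)
    (hAB' : HasAtMostOneNeighbor G A B') (hB'A : HasAtMostOneNeighbor G B' A) :
    h * (G.interedges A B').card ≤ crossInfo f A A' B' := by
  set E := G.interedges A B'
  have hE : ∀ {e : V × V}, e ∈ E → e.1 ∈ A ∧ e.2 ∈ B' ∧ G.Adj e.1 e.2 := fun he =>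
    (SimpleGraph.mem_interedges_iff G).1 he
  have hgain : ∀ e ∈ E,
      h ≤ condMutualInfo f {e.2} A A' + condMutualInfo f {e.1} A' (A.erase e.1) := by
    intro e he
    obtain ⟨ha, hb, hab⟩ := hE he
    obtain ⟨y, hy, hyb⟩ := hB' e.2 hb
    have hindep := hB'A.isIndepSet_insert_erase hA hb ha hab
    have hkey := hf.le_condMutualInfo_add_condMutualInfo
      (Finset.disjoint_left.1 hdisj ha) hindep hab hy hyb
    rwa [Finset.insert_erase ha] at hkey
  have hsnd : Set.InjOn Prod.snd (E : Set (V × V)) := fun e he e' he' heq =>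
    Prod.ext (hB'A e.2 (hE he).2.1 e.1 (hE he).1 e'.1 (hE he').1 (hE he).2.2.symm
      (heq ▸ (hE he').2.2.symm)) heq
  have hfst : Set.InjOn Prod.fst (E : Set (V × V)) := fun e he e' he' heq =>
    Prod.ext heq (hAB' e.1 (hE he).1 e.2 (hE he).2.1 e'.2 (hE he').2.1 (hE he).2.2
      (heq ▸ (hE he').2.2))
  calc h * E.card
      ≤ ∑ e ∈ E, (condMutualInfo f {e.2} A A' + condMutualInfo f {e.1} A' (A.erase e.1)) := by
        rw [mul_comm, ← nsmul_eq_mul]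
        exact Finset.card_nsmul_le_sum _ _ _ hgain
    _ = ∑ b ∈ E.image Prod.snd, condMutualInfo f {b} A A' +
          ∑ a ∈ E.image Prod.fst, condMutualInfo f {a} A' (A.erase a) := by
        rw [Finset.sum_image hsnd, Finset.sum_image hfst, Finset.sum_add_distrib]
    _ ≤ crossInfo f A A' B' := by
        refine add_le_add
          (Finset.sum_le_sum_of_subset_of_nonneg (Finset.image_subset_iff.2 fun e he => (hE he).2.1)
            fun b _ _ => hf.condMutualInfo_nonneg _ _ _)
          (Finset.sum_le_sum_of_subset_of_nonneg (Finset.image_subset_iff.2 fun e he => (hE he).1)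
            fun a _ _ => hf.condMutualInfo_nonneg _ _ _)

/-- The bound of the inductive argument for a bipartite piece `U` of a graph: `totalInfo` is at
least `h` per edge of `U`, except for one edge per vertex of the second color. These `h` are gained
when `totalInfo` is compared with the singletons, see `HasEdgeGain.le_sum_singleton`. -/
def HasEdgeGain (c : G.Coloring Bool) (f : Finset V → ℝ) (h : ℝ) (U : Finset V) : Prop :=
  h * ((G.interedges (colorPart c false U) (colorPart c true U)).card -
    (colorPart c true U).card) ≤ totalInfo f (colorPart c false U) (colorPart c true U)

namespace HasEdgeGain

variable {c : G.Coloring Bool}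

theorem empty : HasEdgeGain c f h ∅ := by
  simp [HasEdgeGain, colorPart, totalInfo]

theorem pair (hf : IsGraphPolymatroid G f h) {v w : V} (hvw : G.Adj v w) :
    HasEdgeGain c f h {v, w} := by
  wlog hv : c v = false generalizing v w
  · have hw : c w = false := Bool.eq_false_of_not_eq_true fun hw =>
      c.valid hvw ((Bool.eq_true_of_not_eq_false hv).trans hw.symm)
    rw [Finset.pair_comm]
    exact this hvw.symm hw
  have hw : c w = true := Bool.eq_true_of_not_eq_false fun hw => c.valid hvw (hv.trans hw.symm)
  have hfalse : colorPart c false {v, w} = {v} := by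
    rw [colorPart, Finset.filter_insert, Finset.filter_singleton]
    simp [hv, hw]
  have htrue : colorPart c true {v, w} = {w} := by
    rw [colorPart, Finset.filter_insert, Finset.filter_singleton]
    simp [hv, hw]
  have hedge : G.interedges {v} {w} = {(v, w)} := by
    simp [SimpleGraph.interedges_def, Finset.filter_singleton, hvw]
  rw [HasEdgeGain, hfalse, htrue, hedge, Finset.card_singleton, Finset.card_singleton, sub_self,
    mul_zero]
  exact add_nonneg (Finset.sum_nonneg fun _ _ => hf.condMutualInfo_nonneg _ _ _)
    (Finset.sum_nonneg fun _ _ => hf.condMutualInfo_nonneg _ _ _)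

theorem union (hf : IsGraphPolymatroid G f h) {U₁ U₂ : Finset V} (hdisj : Disjoint U₁ U₂)
    (hnbr₁ : ∀ v ∈ U₁, ∃ w ∈ U₁, G.Adj w v) (hnbr₂ : ∀ v ∈ U₂, ∃ w ∈ U₂, G.Adj w v)
    (h₁₂ : HasAtMostOneNeighbor G U₁ U₂) (h₂₁ : HasAtMostOneNeighbor G U₂ U₁)
    (h₁ : HasEdgeGain c f h U₁) (h₂ : HasEdgeGain c f h U₂) :
    HasEdgeGain c f h (U₁ ∪ U₂) := by
  have hpart : ∀ x, Disjoint (colorPart c x U₁) (colorPart c x U₂) := fun x =>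
    hdisj.mono (colorPart_subset c x U₁) (colorPart_subset c x U₂)
  have hcross₁ := mul_card_interedges_le_crossInfo hf (hpart false)
    (isIndepSet_colorPart c false U₁) (exists_adj_mem_colorPart c false hnbr₂)
    (h₁₂.mono (colorPart_subset _ _ _) (colorPart_subset _ _ _))
    (h₂₁.mono (colorPart_subset _ _ _) (colorPart_subset _ _ _))
  have hcross₂ := mul_card_interedges_le_crossInfo hf (hpart false).symm
    (isIndepSet_colorPart c false U₂) (exists_adj_mem_colorPart c false hnbr₁)
    (h₂₁.mono (colorPart_subset _ _ _) (colorPart_subset _ _ _))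
    (h₁₂.mono (colorPart_subset _ _ _) (colorPart_subset _ _ _))
  rw [HasEdgeGain] at h₁ h₂ ⊢
  rw [colorPart_union, colorPart_union, totalInfo_union f (hpart false) (hpart true),
    card_interedges_union (hpart false) (hpart true), Finset.card_union_of_disjoint (hpart true)]
  push_cast
  rw [Bool.not_false] at hcross₁ hcross₂
  linarith

theorem le_sum_singleton (hf : IsGraphPolymatroid G f h) {U : Finset V}
    (hnbr : ∀ v ∈ U, ∃ w ∈ U, G.Adj w v) (hU : HasEdgeGain c f h U) :
    h * (G.interedges (colorPart c false U) (colorPart c true U)).card ≤ ∑ v ∈ U, f {v} := by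
  set A := colorPart c false U with hA
  set B := colorPart c true U with hB
  have hsum : ∑ v ∈ U, f {v} = ∑ b ∈ B, f {b} + ∑ a ∈ A, f {a} := by
    rw [← Finset.sum_filter_add_sum_filter_not U fun v => c v = true]
    simp only [Bool.not_eq_true, hA, hB, colorPart]
  have htotal : totalInfo f A B ≤ ∑ b ∈ B, (f {b} - h) + ∑ a ∈ A, f {a} := by
    refine add_le_add (Finset.sum_le_sum fun b hb => ?_)
      (Finset.sum_le_sum fun a _ => hf.condMutualInfo_singleton_empty_le a _)
    obtain ⟨a, ha, hab⟩ := exists_adj_mem_colorPart c false hnbr b hb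
    exact hf.condMutualInfo_singleton_empty_le_sub (isIndepSet_colorPart c false U) ha hab
  rw [Finset.sum_sub_distrib, Finset.sum_const, nsmul_eq_mul] at htotal
  rw [HasEdgeGain] at hU
  linarith

end HasEdgeGain

end Polymatroid

section Lattice

variable {d : ℕ}

theorem abs_sub_eq_one_of_latticeGraph_adj {v w : Fin d → ℤ} (hvw : (latticeGraph d).Adj v w) :
    |∑ i, v i - ∑ i, w i| = 1 := by
  obtain ⟨i, hi, hne⟩ := hvw
  rw [← Finset.sum_sub_distrib, Finset.sum_eq_single i (fun j _ hj => sub_eq_zero.2 (hne j hj))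
    (by simp), hi]

/-- The chessboard coloring of the lattice, by the parity of the sum of the coordinates. -/
def latticeColoring (d : ℕ) : (latticeGraph d).Coloring Bool :=
  SimpleGraph.Coloring.mk (fun v => decide (Even (∑ i, v i))) fun {v w} hvw heq => by
    have habs := abs_sub_eq_one_of_latticeGraph_adj hvw
    have heven : Even (∑ i, v i - ∑ i, w i) := Int.even_sub.2 (decide_eq_decide.1 heq)
    rw [← even_abs, habs] at heven
    exact absurd heven (by decide)

theorem latticeGraph_adj_add_single (v : Fin d → ℤ) (i : Fin d) :
    (latticeGraph d).Adj v (v + Pi.single i 1) :=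
  ⟨i, by simp, fun j hj => by simp [hj]⟩

theorem eq_add_single_of_latticeGraph_adj {v w : Fin d → ℤ} {i : Fin d}
    (hvw : (latticeGraph d).Adj v w) (hlt : v i < w i) : w = v + Pi.single i 1 := by
  obtain ⟨j, hj, hne⟩ := hvw
  obtain rfl : i = j := by_contra fun hij => hlt.ne (hne i hij)
  funext l
  rcases eq_or_ne l i with rfl | hl
  · rw [abs_sub_comm, abs_of_pos (sub_pos.2 hlt)] at hj
    simp [← hj]
  · simp [hl, hne l hl]

theorem injective_sym2_mk_add_single :
    Function.Injective fun p : Fin d × (Fin d → ℤ) => s(p.2, p.2 + Pi.single p.1 (1 : ℤ)) := by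
  rintro ⟨i, v⟩ ⟨j, w⟩ heq
  rcases Sym2.eq_iff.1 heq with ⟨hvw, hadd⟩ | ⟨hv, hw⟩
  · dsimp only at hvw hadd
    rw [hvw, add_left_cancel_iff] at hadd
    have hi := congrFun hadd i
    rw [Pi.single_eq_same, Pi.single_apply] at hi
    have hij : i = j := by
      by_contra hij
      rw [if_neg hij] at hi
      exact one_ne_zero hi
    rw [hij, hvw]
  · dsimp only at hv hw
    have hzero := congrFun hw i
    have hpos : 0 ≤ (Pi.single j 1 : Fin d → ℤ) i := by
      rw [Pi.single_apply]
      split_ifs <;> simp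
    simp only [hv, Pi.add_apply, Pi.single_eq_same] at hzero
    omega

/-- The map merging the points of the lattice into pairs of neighbors in direction `i`, by halving
the `i`-th coordinate. The lower bound is proved by cutting a set of points along hyperplanes which
separate no such pair. -/
def halve (i : Fin d) (v : Fin d → ℤ) : Fin d → ℤ :=
  Function.update v i (v i / 2)

theorem halve_eq_halve_iff {i : Fin d} {v w : Fin d → ℤ} :
    halve i v = halve i w ↔ v i / 2 = w i / 2 ∧ ∀ j, j ≠ i → v j = w j := by
  simp only [halve, Function.update_eq_iff, Function.update_self]
  exact and_congr_right fun _ => forall₂_congr fun j hj => by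
    rw [Function.update_of_ne hj]

theorem eq_of_halve_eq {i : Fin d} {v w : Fin d → ℤ} (heq : halve i v = halve i w)
    (hi : v i = w i) : v = w := by
  funext j
  rcases eq_or_ne j i with rfl | hj
  · exact hi
  · exact (halve_eq_halve_iff.1 heq).2 j hj

theorem latticeGraph_adj_of_halve_eq {i : Fin d} {v w : Fin d → ℤ} (hvw : v ≠ w)
    (heq : halve i v = halve i w) : (latticeGraph d).Adj v w := by
  obtain ⟨hdiv, hne⟩ := halve_eq_halve_iff.1 heq
  have hi : v i ≠ w i := mt (eq_of_halve_eq heq) hvw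
  exact ⟨i, by grind, hne⟩

theorem eq_or_eq_of_halve_eq {i : Fin d} {u v w : Fin d → ℤ} (hvw : v ≠ w)
    (hwv : halve i w = halve i v) (huv : halve i u = halve i v) : u = v ∨ u = w := by
  have hdiv := (halve_eq_halve_iff.1 hwv).1
  have hdiv' := (halve_eq_halve_iff.1 huv).1
  have hi : v i ≠ w i := mt (eq_of_halve_eq hwv.symm) hvw
  have hu : u i = v i ∨ u i = w i := by omega
  exact hu.imp (eq_of_halve_eq huv) (eq_of_halve_eq (huv.trans hwv.symm))

theorem lt_of_halve_lt {i j : Fin d} {v w : Fin d → ℤ} (hlt : halve i v j < halve i w j) :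
    v j < w j := by
  rcases eq_or_ne j i with rfl | hj
  · simp only [halve, Function.update_self] at hlt
    omega
  · simpa only [halve, Function.update_of_ne hj] using hlt

theorem card_latticeBox (d k : ℕ) : (latticeBox d k).card = k ^ d := by
  simp [latticeBox, Fintype.card_piFinset]

theorem mem_latticeBox {k : ℕ} {v : Fin d → ℤ} :
    v ∈ latticeBox d k ↔ ∀ i, 0 ≤ v i ∧ v i < k := by
  simp [latticeBox, Fintype.mem_piFinset]

theorem latticeBox_mono (d : ℕ) {k l : ℕ} (hkl : k ≤ l) : latticeBox d k ⊆ latticeBox d l :=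
  fun _ hv => mem_latticeBox.2 fun i =>
    ⟨(mem_latticeBox.1 hv i).1, (mem_latticeBox.1 hv i).2.trans_le (Nat.cast_le.2 hkl)⟩

theorem add_single_mem_latticeBox {k : ℕ} {v : Fin d → ℤ} (i : Fin d)
    (hv : v ∈ latticeBox d (k - 1)) : v + Pi.single i 1 ∈ latticeBox d k := by
  refine mem_latticeBox.2 fun j => ?_
  have hj := mem_latticeBox.1 hv j
  rw [Pi.add_apply, Pi.single_apply]
  split_ifs <;> grind

theorem exists_ne_halve_eq_mem_latticeBox {k : ℕ} {v : Fin d → ℤ} (i : Fin d)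
    (hv : v ∈ latticeBox d (k - 1)) :
    ∃ w ∈ latticeBox d k, w ≠ v ∧ halve i w = halve i v := by
  rw [mem_latticeBox] at hv
  refine ⟨Function.update v i (4 * (v i / 2) + 1 - v i), mem_latticeBox.2 fun j => ?_,
    fun heq => ?_, halve_eq_halve_iff.2 ⟨?_, fun j hj => Function.update_of_ne hj _ _⟩⟩
  · have hj := hv j
    rcases eq_or_ne j i with rfl | hji
    · rw [Function.update_self]
      omega
    · rw [Function.update_of_ne hji]
      omega
  · have hi := congrFun heq i
    rw [Function.update_self] at hi
    omega
  · rw [Function.update_self]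
    omega

variable {V : Type*} {H : SimpleGraph V} (φ : H ↪g latticeGraph d)

/-- The finite set `U` of vertices of a graph embedded in the lattice is a union of pairs of points
which are merged by `halve i`. -/
def IsHalvePaired (i : Fin d) (U : Finset V) : Prop :=
  ∀ v ∈ U, ∃ w ∈ U, w ≠ v ∧ halve i (φ w) = halve i (φ v)

variable {φ} {i : Fin d} {U : Finset V}

theorem IsHalvePaired.exists_adj (hU : IsHalvePaired φ i U) : ∀ v ∈ U, ∃ w ∈ U, H.Adj w v :=
  fun v hv =>
    let ⟨w, hw, hwv, heq⟩ := hU v hv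
    ⟨w, hw, φ.map_adj_iff.1 (latticeGraph_adj_of_halve_eq (φ.injective.ne hwv) heq)⟩

theorem IsHalvePaired.filter (hU : IsHalvePaired φ i U) (p : (Fin d → ℤ) → Prop)
    [DecidablePred p] : IsHalvePaired φ i (U.filter fun v => p (halve i (φ v))) := by
  intro v hv
  obtain ⟨hvU, hpv⟩ := Finset.mem_filter.1 hv
  obtain ⟨w, hw, hwv, heq⟩ := hU v hvU
  exact ⟨w, Finset.mem_filter.2 ⟨hw, heq ▸ hpv⟩, hwv, heq⟩

theorem hasAtMostOneNeighbor_of_halve_lt {U₁ U₂ : Finset V} {j : Fin d}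
    (hlt : ∀ v ∈ U₁, ∀ w ∈ U₂, halve i (φ v) j < halve i (φ w) j) :
    HasAtMostOneNeighbor H U₁ U₂ ∧ HasAtMostOneNeighbor H U₂ U₁ := by
  have hstep : ∀ v ∈ U₁, ∀ w ∈ U₂, H.Adj v w → φ w = φ v + Pi.single j 1 := fun v hv w hw hvw =>
    eq_add_single_of_latticeGraph_adj (φ.map_adj_iff.2 hvw) (lt_of_halve_lt (hlt v hv w hw))
  refine ⟨fun v hv w hw w' hw' hvw hvw' => φ.injective ?_,
    fun w hw v hv v' hv' hwv hwv' => φ.injective ?_⟩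
  · rw [hstep v hv w hw hvw, hstep v hv w' hw' hvw']
  · exact add_right_cancel
      ((hstep v hv w hw hwv.symm).symm.trans (hstep v' hv' w hw hwv'.symm))

variable [DecidableRel H.Adj]

theorem sym2_mk_mem_image_interedges_colorPart {α : Type*} [DecidableEq α] (c : H.Coloring Bool)
    (g : V → α) {v w : V} (hv : v ∈ U) (hw : w ∈ U) (hvw : H.Adj v w) :
    s(g v, g w) ∈ (H.interedges (colorPart c false U) (colorPart c true U)).image fun e =>
      s(g e.1, g e.2) := by
  wlog hcv : c v = false generalizing v w
  · rw [Sym2.eq_swap]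
    have hne := c.valid hvw
    rw [Bool.eq_true_of_not_eq_false hcv] at hne
    exact this hw hv hvw.symm (Bool.eq_false_of_not_eq_true hne.symm)
  have hne := c.valid hvw
  rw [hcv] at hne
  have hcw : c w = true := Bool.eq_true_of_not_eq_false hne.symm
  exact Finset.mem_image_of_mem (fun e : V × V => s(g e.1, g e.2))
    ((SimpleGraph.mk_mem_interedges_iff H).2
      ⟨(mem_colorPart c _).2 ⟨hv, hcv⟩, (mem_colorPart c _).2 ⟨hw, hcw⟩, hvw⟩)

theorem mul_card_le_card_interedges (φ : H ↪g latticeGraph d) (c : H.Coloring Bool)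
    {Q : Finset (Fin d → ℤ)} (hQ : ∀ q ∈ Q, ∃ v ∈ U, φ v = q)
    (hQ' : ∀ q ∈ Q, ∀ i, ∃ w ∈ U, φ w = q + Pi.single i 1) :
    d * Q.card ≤ (H.interedges (colorPart c false U) (colorPart c true U)).card := by
  calc d * Q.card
      = ((Finset.univ ×ˢ Q).image fun p : Fin d × (Fin d → ℤ) =>
          s(p.2, p.2 + Pi.single p.1 (1 : ℤ))).card := by
        rw [Finset.card_image_of_injective _ injective_sym2_mk_add_single, Finset.card_product,
          Finset.card_univ, Fintype.card_fin]
    _ ≤ ((H.interedges (colorPart c false U) (colorPart c true U)).image fun e =>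
          s(φ e.1, φ e.2)).card := by
        refine Finset.card_le_card (Finset.image_subset_iff.2 fun p hp => ?_)
        obtain ⟨v, hv, hφv⟩ := hQ p.2 (Finset.mem_product.1 hp).2
        obtain ⟨w, hw, hφw⟩ := hQ' p.2 (Finset.mem_product.1 hp).2 p.1
        rw [← hφw, ← hφv]
        refine sym2_mk_mem_image_interedges_colorPart c φ hv hw (φ.map_adj_iff.1 ?_)
        rw [hφv, hφw]
        exact latticeGraph_adj_add_single _ _
    _ ≤ (H.interedges (colorPart c false U) (colorPart c true U)).card := Finset.card_image_le

variable [DecidableEq V] {f : Finset V → ℝ} {h : ℝ}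

theorem IsHalvePaired.hasEdgeGain (hf : IsGraphPolymatroid H f h) (c : H.Coloring Bool)
    (hU : IsHalvePaired φ i U) : HasEdgeGain c f h U := by
  induction U using Finset.strongInduction with | H U ih =>
  by_cases hconst : ∀ v ∈ U, ∀ w ∈ U, halve i (φ v) = halve i (φ w)
  · rcases U.eq_empty_or_nonempty with rfl | ⟨v, hv⟩
    · exact HasEdgeGain.empty
    obtain ⟨w, hw, hwv, heq⟩ := hU v hv
    have hpair : U = {v, w} := by
      refine Finset.Subset.antisymm (fun u hu => ?_) (by simp [Finset.insert_subset_iff, hv, hw])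
      rcases eq_or_eq_of_halve_eq (φ.injective.ne hwv.symm) heq (hconst u hu v hv) with h | h
      · simp [φ.injective h]
      · simp [φ.injective h]
    rw [hpair]
    exact HasEdgeGain.pair hf
      (φ.map_adj_iff.1 (latticeGraph_adj_of_halve_eq (φ.injective.ne hwv.symm) heq.symm))
  · obtain ⟨v, hv, w, hw, j, hlt⟩ :
        ∃ v ∈ U, ∃ w ∈ U, ∃ j, halve i (φ v) j < halve i (φ w) j := by
      push Not at hconst
      obtain ⟨v, hv, w, hw, hne⟩ := hconst
      obtain ⟨j, hj⟩ := Function.ne_iff.1 hne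
      rcases hj.lt_or_gt with hlt | hlt
      exacts [⟨v, hv, w, hw, j, hlt⟩, ⟨w, hw, v, hv, j, hlt⟩]
    let p : (Fin d → ℤ) → Prop := fun x => x j ≤ halve i (φ v) j
    have hp := hU.filter p
    have hnp := hU.filter fun x => ¬ p x
    obtain ⟨h₁₂, h₂₁⟩ := hasAtMostOneNeighbor_of_halve_lt (φ := φ) (i := i) (j := j)
      (U₁ := U.filter fun u => p (halve i (φ u))) (U₂ := U.filter fun u => ¬ p (halve i (φ u)))
      fun a ha b hb =>
        (Finset.mem_filter.1 ha).2.trans_lt (not_le.1 (Finset.mem_filter.1 hb).2)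
    rw [← Finset.filter_union_filter_not_eq (fun u => p (halve i (φ u))) U]
    exact HasEdgeGain.union hf (Finset.disjoint_filter_filter_not _ _ _) hp.exists_adj
      hnp.exists_adj h₁₂ h₂₁
      (ih _ (Finset.filter_ssubset.2 ⟨w, hw, not_le.2 hlt⟩) hp)
      (ih _ (Finset.filter_ssubset.2 ⟨v, hv, not_not.2 le_rfl⟩) hnp)

end Lattice

theorem IsGraphPolymatroid.mul_le_sum_singleton_latticeBox {d k : ℕ} [NeZero d]
    {f : Finset (latticeBox d k : Set (Fin d → ℤ)) → ℝ} {h : ℝ}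
    (hf : IsGraphPolymatroid ((latticeGraph d).induce (latticeBox d k : Set (Fin d → ℤ))) f h)
    (hh : 0 ≤ h) : h * (d * (k - 2) ^ d : ℕ) ≤ ∑ v, f {v} := by
  classical
  set H := (latticeGraph d).induce (latticeBox d k : Set (Fin d → ℤ))
  let φ : H ↪g latticeGraph d := SimpleGraph.Embedding.induce _
  let c : H.Coloring Bool := (latticeColoring d).comp φ.toHom
  let U : Finset (latticeBox d k : Set (Fin d → ℤ)) :=
    Finset.univ.filter fun v => ∃ w, w ≠ v ∧ halve 0 (φ w) = halve 0 (φ v)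
  have hU : IsHalvePaired φ 0 U := fun v hv => by
    obtain ⟨w, hwv, heq⟩ := (Finset.mem_filter.1 hv).2
    exact ⟨w, Finset.mem_filter.2 ⟨Finset.mem_univ w, v, hwv.symm, heq.symm⟩, hwv, heq⟩
  have hinner : ∀ x ∈ latticeBox d (k - 1), ∃ v ∈ U, φ v = x := fun x hx => by
    obtain ⟨w, hw, hwx, heq⟩ := exists_ne_halve_eq_mem_latticeBox 0 hx
    refine ⟨⟨x, latticeBox_mono d (Nat.sub_le k 1) hx⟩, Finset.mem_filter.2 ⟨Finset.mem_univ _,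
      ⟨w, hw⟩, fun h => hwx (congrArg Subtype.val h), heq⟩, rfl⟩
  have hcard : d * (k - 2) ^ d ≤
      (H.interedges (colorPart c false U) (colorPart c true U)).card := by
    rw [← card_latticeBox]
    exact mul_card_le_card_interedges φ c
      (fun q hq => hinner q (latticeBox_mono d (by omega) hq))
      fun q hq i => hinner _ (add_single_mem_latticeBox i hq)
  calc h * (d * (k - 2) ^ d : ℕ)
      ≤ h * (H.interedges (colorPart c false U) (colorPart c true U)).card := by gcongr
    _ ≤ ∑ v ∈ U, f {v} := (hU.hasEdgeGain hf c).le_sum_singleton hf hU.exists_adj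
    _ ≤ ∑ v, f {v} :=
        Finset.sum_le_sum_of_subset_of_nonneg (Finset.subset_univ U) fun v _ _ => hf.nonneg {v}

namespace SecretSharingScheme

variable {V : Type} {G : SimpleGraph V} (S : SecretSharingScheme G)

/-- The shares of a finite set of vertices, as a single random variable. -/
def jointShare (A : Finset V) (ω : S.Ω) (v : A) : S.Share v :=
  S.share v ω

theorem measurable_jointShare (A : Finset V) : Measurable (S.jointShare A) :=
  measurable_pi_lambda _ fun v => S.measurable_share v

theorem exists_secret_ae_eq_comp_jointShare {A : Finset V} (hA : ¬ G.IsIndepSet A) :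
    ∃ g : ((v : A) → S.Share v) → S.Secret, S.secret =ᵐ[S.μ] g ∘ S.jointShare A := by
  simp only [SimpleGraph.IsIndepSet, Set.Pairwise, not_forall, not_not] at hA
  obtain ⟨v, hv, w, hw, -, hadj⟩ := hA
  obtain ⟨g, hg⟩ := S.recover v w hadj
  exact ⟨fun x => g (x ⟨v, hv⟩) (x ⟨w, hw⟩), hg⟩

theorem exists_prodMk_ae_eq_comp_jointShare {A B : Finset V} (hAB : A ⊆ B)
    (hB : ¬ G.IsIndepSet B) :
    ∃ g : ((v : B) → S.Share v) → S.Secret × ((v : A) → S.Share v),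
      (fun ω => (S.secret ω, S.jointShare A ω)) =ᵐ[S.μ] g ∘ S.jointShare B := by
  obtain ⟨g, hg⟩ := S.exists_secret_ae_eq_comp_jointShare hB
  exact ⟨fun x => (g x, fun v => x ⟨v, hAB v.2⟩), hg.mono fun ω hω => Prod.ext hω rfl⟩

theorem entropy_secret_jointShare {A : Finset V} (hA : G.IsIndepSet A) :
    shannonEntropy S.μ (fun ω => (S.secret ω, S.jointShare A ω)) =
      shannonEntropy S.μ S.secret + shannonEntropy S.μ (S.jointShare A) :=
  shannonEntropy_prodMk_of_indepFun S.measurable_secret (S.measurable_jointShare A)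
    (S.perfect A hA)

theorem entropy_jointShare_empty : shannonEntropy S.μ (S.jointShare ∅) = 0 :=
  shannonEntropy_of_unique _

theorem entropy_jointShare_singleton (v : V) :
    shannonEntropy S.μ (S.jointShare {v}) = shannonEntropy S.μ (S.share v) := by
  refine le_antisymm ?_ ?_
  · refine shannonEntropy_le_of_ae_eq_comp (S.measurable_share v)
      (fun x w => (Finset.mem_singleton.1 w.2).symm ▸ x) (ae_of_all _ fun ω => ?_)
    funext ⟨w, hw⟩
    obtain rfl := Finset.mem_singleton.1 hw
    rfl
  · exact shannonEntropy_le_of_ae_eq_comp (S.measurable_jointShare {v})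
      (fun x => x ⟨v, Finset.mem_singleton_self v⟩) (ae_of_all _ fun _ => rfl)

theorem entropy_jointShare_mono {A B : Finset V} (h : A ⊆ B) :
    shannonEntropy S.μ (S.jointShare A) ≤ shannonEntropy S.μ (S.jointShare B) :=
  shannonEntropy_le_of_ae_eq_comp (S.measurable_jointShare B) (fun x v => x ⟨v, h v.2⟩)
    (ae_of_all _ fun _ => rfl)

theorem entropy_jointShare_strict_mono {A B : Finset V} (hAB : A ⊆ B) (hA : G.IsIndepSet A)
    (hB : ¬ G.IsIndepSet B) :
    shannonEntropy S.μ (S.jointShare A) + shannonEntropy S.μ S.secret ≤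
      shannonEntropy S.μ (S.jointShare B) := by
  obtain ⟨g, hg⟩ := S.exists_prodMk_ae_eq_comp_jointShare hAB hB
  rw [add_comm, ← S.entropy_secret_jointShare hA]
  exact shannonEntropy_le_of_ae_eq_comp (S.measurable_jointShare B) g hg

variable [DecidableEq V]

theorem exists_jointShare_union_eq (A B : Finset V) :
    ∃ g : ((v : A) → S.Share v) × ((v : B) → S.Share v) →
        (v : (A ∪ B : Finset V)) → S.Share v,
      S.jointShare (A ∪ B) =ᵐ[S.μ] fun ω => g (S.jointShare A ω, S.jointShare B ω) := by
  refine ⟨fun x v => if h : v.1 ∈ A then x.1 ⟨v, h⟩ else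
    x.2 ⟨v, (Finset.mem_union.1 v.2).resolve_left h⟩, ae_of_all _ fun ω => ?_⟩
  funext v
  by_cases h : v.1 ∈ A
  · simp only [dif_pos h]
    rfl
  · simp only [dif_neg h]
    rfl

theorem entropy_jointShare_submodular (A B : Finset V) :
    shannonEntropy S.μ (S.jointShare (A ∪ B)) + shannonEntropy S.μ (S.jointShare (A ∩ B)) ≤
      shannonEntropy S.μ (S.jointShare A) + shannonEntropy S.μ (S.jointShare B) := by
  obtain ⟨g, hg⟩ := S.exists_jointShare_union_eq A B
  exact shannonEntropy_add_le_of_ae_eq_comp (S.measurable_jointShare A)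
    (S.measurable_jointShare B) (S.measurable_jointShare (A ∩ B))
    (fun x v => x ⟨v, Finset.inter_subset_left v.2⟩) (ae_of_all _ fun _ => rfl)
    (fun x v => x ⟨v, Finset.inter_subset_right v.2⟩) (ae_of_all _ fun _ => rfl) g hg

theorem entropy_jointShare_strict_submodular {A B : Finset V} (hA : ¬ G.IsIndepSet A)
    (hB : ¬ G.IsIndepSet B) (hAB : G.IsIndepSet (A ∩ B : Finset V)) :
    shannonEntropy S.μ (S.jointShare (A ∪ B)) + (shannonEntropy S.μ (S.jointShare (A ∩ B)) +
      shannonEntropy S.μ S.secret) ≤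
      shannonEntropy S.μ (S.jointShare A) + shannonEntropy S.μ (S.jointShare B) := by
  obtain ⟨p, hp⟩ := S.exists_prodMk_ae_eq_comp_jointShare (A := A ∩ B) Finset.inter_subset_left hA
  obtain ⟨q, hq⟩ := S.exists_prodMk_ae_eq_comp_jointShare (A := A ∩ B) Finset.inter_subset_right hB
  obtain ⟨g, hg⟩ := S.exists_jointShare_union_eq A B
  rw [add_comm (shannonEntropy S.μ (S.jointShare (A ∩ B))), ← S.entropy_secret_jointShare hAB]
  exact shannonEntropy_add_le_of_ae_eq_comp (S.measurable_jointShare A)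
    (S.measurable_jointShare B) (S.measurable_secret.prodMk (S.measurable_jointShare (A ∩ B)))
    p hp q hq g hg

omit [DecidableEq V] in
theorem entropy_jointShare_ne_top (hfin : ∀ v, shannonEntropy S.μ (S.share v) ≠ ∞)
    (A : Finset V) : shannonEntropy S.μ (S.jointShare A) ≠ ∞ := by
  classical
  induction A using Finset.induction_on with
  | empty => simp [S.entropy_jointShare_empty]
  | insert v A _ ih =>
    have h := S.entropy_jointShare_submodular {v} A
    rw [← Finset.insert_eq, S.entropy_jointShare_singleton] at h
    exact ne_top_of_le_ne_top (ENNReal.add_ne_top.2 ⟨hfin v, ih⟩) (le_self_add.trans h)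

theorem isGraphPolymatroid_entropy (hfin : ∀ v, shannonEntropy S.μ (S.share v) ≠ ∞) :
    IsGraphPolymatroid G (fun A => (shannonEntropy S.μ (S.jointShare A)).toReal)
      (shannonEntropy S.μ S.secret).toReal := by
  have hF := S.entropy_jointShare_ne_top hfin
  have hS := S.entropy_secret_lt_top.ne
  have hFF : ∀ A B,
      shannonEntropy S.μ (S.jointShare A) + shannonEntropy S.μ (S.jointShare B) ≠ ∞ :=
    fun A B => ENNReal.add_ne_top.2 ⟨hF A, hF B⟩
  exact {
    empty := by simp [S.entropy_jointShare_empty]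
    mono := fun hAB => ENNReal.toReal_mono (hF _) (S.entropy_jointShare_mono hAB)
    submodular := fun A B => by
      rw [← ENNReal.toReal_add (hF _) (hF _), ← ENNReal.toReal_add (hF _) (hF _)]
      exact ENNReal.toReal_mono (hFF A B) (S.entropy_jointShare_submodular A B)
    strict_mono := fun hAB hA hB => by
      rw [← ENNReal.toReal_add (hF _) hS]
      exact ENNReal.toReal_mono (hF _) (S.entropy_jointShare_strict_mono hAB hA hB)
    strict_submodular := fun {A B} hA hB hAB => by
      rw [add_assoc, ← ENNReal.toReal_add (hF _) hS,
        ← ENNReal.toReal_add (hF _) (ENNReal.add_ne_top.2 ⟨hF _, hS⟩),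
        ← ENNReal.toReal_add (hF _) (hF _)]
      exact ENNReal.toReal_mono (hFF A B) (S.entropy_jointShare_strict_submodular hA hB hAB) }

theorem natCast_le_sum_ratio [Fintype V] {n : ℕ}
    (hn : ∀ {f h}, IsGraphPolymatroid G f h → 0 ≤ h → h * n ≤ ∑ v, f {v}) :
    (n : ℝ≥0∞) ≤ ∑ v, S.ratio v := by
  have hS := S.entropy_secret_lt_top.ne
  simp only [SecretSharingScheme.ratio, div_eq_mul_inv]
  rw [← Finset.sum_mul, ← div_eq_mul_inv,
    ENNReal.le_div_iff_mul_le (Or.inl S.entropy_secret_pos.ne') (Or.inl hS)]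
  by_cases hfin : ∀ v, shannonEntropy S.μ (S.share v) ≠ ∞
  · have hle := hn (S.isGraphPolymatroid_entropy hfin) ENNReal.toReal_nonneg
    simp only [S.entropy_jointShare_singleton] at hle
    rw [← ENNReal.toReal_sum fun v _ => hfin v, mul_comm, ← ENNReal.toReal_natCast,
      ← ENNReal.toReal_mul] at hle
    exact (ENNReal.toReal_le_toReal (ENNReal.mul_ne_top (ENNReal.natCast_ne_top n) hS)
      (ENNReal.sum_ne_top.2 fun v _ => hfin v)).1 hle
  · push Not at hfin
    obtain ⟨v, hv⟩ := hfin
    rw [ENNReal.sum_eq_top.2 ⟨v, Finset.mem_univ v, hv⟩]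
    exact le_top

end SecretSharingScheme

theorem le_spannedAverageRatio_latticeBox (d k : ℕ) [NeZero d] :
    ((d * (k - 2) ^ d : ℕ) : ℝ≥0∞) / ((k ^ d : ℕ) : ℝ≥0∞) ≤
      spannedAverageRatio (latticeGraph d) (latticeBox d k) := by
  refine le_iInf fun S => ?_
  have hcard : Fintype.card (latticeBox d k : Set (Fin d → ℤ)) = k ^ d := by
    rw [← card_latticeBox d k]
    simp
  rw [SecretSharingScheme.averageRatio, hcard]
  gcongr
  exact S.natCast_le_sum_ratio IsGraphPolymatroid.mul_le_sum_singleton_latticeBox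

theorem tendsto_mul_sub_two_pow_div_pow (d : ℕ) :
    Tendsto (fun k : ℕ => ((d * (k - 2) ^ d : ℕ) : ℝ≥0∞) / ((k ^ d : ℕ) : ℝ≥0∞)) atTop
      (𝓝 (d : ℝ≥0∞)) := by
  have hratio : Tendsto (fun k : ℕ => 1 - 2 / (k : ℝ)) atTop (𝓝 1) := by
    simpa using tendsto_const_nhds.sub (tendsto_const_div_atTop_nhds_zero_nat (2 : ℝ))
  have hreal : Tendsto (fun k : ℕ => (d : ℝ) * (1 - 2 / (k : ℝ)) ^ d) atTop (𝓝 (d : ℝ)) := by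
    simpa using (hratio.pow d).const_mul (d : ℝ)
  rw [← ENNReal.ofReal_natCast]
  refine (ENNReal.tendsto_ofReal hreal).congr' ?_
  filter_upwards [eventually_ge_atTop 2] with k hk
  have hk₀ : (0 : ℝ) < k := by exact_mod_cast two_pos.trans_le hk
  have hquot : (d : ℝ) * (1 - 2 / (k : ℝ)) ^ d = (d * (k - 2) ^ d : ℕ) / (k ^ d : ℕ) := by
    push_cast [hk]
    rw [mul_div_assoc, ← div_pow, sub_div, div_self hk₀.ne']
  rw [hquot, ENNReal.ofReal_div_of_pos (by positivity), ENNReal.ofReal_natCast,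
    ENNReal.ofReal_natCast]

section Biclique

/-- The distribution of a family of independent uniform elements of `Γ`. -/
noncomputable def uniformFamily (ι Γ : Type) [MeasurableSpace Γ] : Measure (ι → Γ) :=
  Measure.infinitePi fun _ => uniformOn Set.univ

section UniformFamily

variable {ι Γ : Type} [Finite Γ] [Nonempty Γ] [MeasurableSpace Γ]

instance : IsProbabilityMeasure (uniformFamily ι Γ) :=
  inferInstanceAs (IsProbabilityMeasure (Measure.infinitePi _))

theorem map_add_right_uniformFamily [AddGroup Γ] [DiscreteMeasurableSpace Γ] (c : ι → Γ) :
    (uniformFamily ι Γ).map (fun r => r + c) = uniformFamily ι Γ := by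
  have hshift : ∀ a : Γ, (uniformOn Set.univ).map (fun x => x + a) = uniformOn Set.univ := by
    intro a
    rw [uniformOn, ProbabilityTheory.cond, Measure.restrict_univ]
    exact map_add_right_eq_self _ a
  have h := Measure.infinitePi_map_pi (fun _ : ι => uniformOn (Set.univ : Set Γ))
    (f := fun i x => x + c i) fun i => measurable_of_countable _
  simp only [hshift] at h
  exact h

end UniformFamily

/-- A family, indexed by `P`, of partitions of the vertices of `G` into blocks which span complete
bipartite graphs, together with an assignment of parts of a secret in `K` to the members of the
family, such that the parts belonging to the partitions which do not separate the ends of an edge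
determine the secret. The block of the vertex `v` in the partition `p` is named by a label
`block p v` in `L`; parts of the secret are elements of a group `Γ`. -/
structure BicliqueSystem {V : Type} (G : SimpleGraph V) (P L K Γ : Type) where
  /-- the two sides of all bicliques -/
  color : G.Coloring Bool
  /-- the label of the block of a vertex in a partition -/
  block : P → V → L
  /-- the part of the secret which is distributed on each block of a partition -/
  part : P → K → Γ
  color_eq_of_not_adj : ∀ {p v w}, block p v = block p w → ¬ G.Adj v w → color v = color w
  eq_of_part_eq : ∀ {v w s s'}, G.Adj v w →
    (∀ p, block p v = block p w → part p s = part p s') → s = s'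

namespace BicliqueSystem

variable {V P L K Γ : Type} {G : SimpleGraph V} [AddGroup Γ] (B : BicliqueSystem G P L K Γ)

/-- The share of `v` for the secret `ω.1` and the family `ω.2` of random pads, one for each block:
on either side of a biclique the pad of the block, to which the part of the secret is added on the
side of color `true`. -/
def share (v : V) (ω : K × (P × L → Γ)) (p : P) : Γ :=
  ω.2 (p, B.block p v) + if B.color v then B.part p ω.1 else 0

theorem exists_recover [Nonempty K] {v w : V} (hvw : G.Adj v w) :
    ∃ g : (P → Γ) → (P → Γ) → K, ∀ ω, ω.1 = g (B.share v ω) (B.share w ω) := by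
  have hfactor : Function.FactorsThrough (fun ω : K × (P × L → Γ) => ω.1)
      fun ω => (B.share v ω, B.share w ω) := by
    intro ω ω' heq
    obtain ⟨hv, hw⟩ := Prod.mk.inj heq
    refine B.eq_of_part_eq hvw fun p hp => ?_
    have hpv := congrFun hv p
    have hpw := congrFun hw p
    simp only [share, hp] at hpv hpw
    have hne := B.color.valid hvw
    cases hcv : B.color v <;> cases hcw : B.color w <;> simp_all
  obtain ⟨g, hg⟩ := (Function.factorsThrough_iff _).1 hfactor
  exact ⟨fun x y => g (x, y), congrFun hg⟩

/-- The part of the secret which is added to the pad of a block in the shares of the elements of an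
independent set `A`, all of whose elements in the block lie on the same side. -/
noncomputable def mask (A : Set V) (s : K) (q : P × L) : Γ :=
  open Classical in if ∃ v ∈ A, B.block q.1 v = q.2 ∧ B.color v then B.part q.1 s else 0

theorem ite_part_eq_mask {A : Set V} (hA : G.IsIndepSet A) {v : V} (hv : v ∈ A) (p : P) (s : K) :
    (if B.color v then B.part p s else 0) = B.mask A s (p, B.block p v) := by
  classical
  rw [mask]
  refine if_congr ⟨fun hc => ⟨v, hv, rfl, hc⟩, ?_⟩ rfl rfl
  rintro ⟨w, hw, hblock, hc⟩
  rwa [← B.color_eq_of_not_adj hblock fun hwv => hA hw hv hwv.ne hwv]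

variable [Countable K] [MeasurableSpace K] [DiscreteMeasurableSpace K] [Finite Γ]
  [MeasurableSpace Γ] [DiscreteMeasurableSpace Γ]

theorem measurable_share (v : V) : Measurable (B.share v) :=
  measurable_pi_lambda _ fun p => ((measurable_pi_apply _).comp measurable_snd).add
    ((measurable_of_countable fun s => if B.color v then B.part p s else 0).comp measurable_fst)

theorem measurePreserving_add_mask (μ : Measure K) [SFinite μ] (A : Set V) :
    MeasurePreserving (fun ω : K × (P × L → Γ) => (ω.1, ω.2 + B.mask A ω.1))
      (μ.prod (uniformFamily _ Γ)) (μ.prod (uniformFamily _ Γ)) := by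
  refine MeasurePreserving.skew_product (MeasurePreserving.id _) (g := fun s r => r + B.mask A s)
    ?_ (ae_of_all _ fun s => map_add_right_uniformFamily _)
  exact measurable_pi_lambda _ fun q => ((measurable_pi_apply q).comp measurable_snd).add
    ((measurable_of_countable fun s => B.mask A s q).comp measurable_fst)

/-- Adding `mask A` to the pads preserves the distribution, and turns the pads into the shares of
`A`. -/
theorem indepFun_secret_share (μ : Measure K) [IsProbabilityMeasure μ] {A : Set V}
    (hA : G.IsIndepSet A) :
    IndepFun Prod.fst (fun ω (v : A) => B.share v.1 ω) (μ.prod (uniformFamily (P × L) Γ)) := by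
  let pads : (P × L → Γ) → A → P → Γ := fun r v p => r (p, B.block p v)
  have hpads : Measurable pads :=
    measurable_pi_lambda _ fun v => measurable_pi_lambda _ fun p => measurable_pi_apply _
  have hshare : (fun (ω : K × (P × L → Γ)) (v : A) => B.share v.1 ω) =
      fun ω => pads (ω.2 + B.mask A ω.1) := by
    funext ω v p
    rw [share, B.ite_part_eq_mask hA v.2]
    rfl
  have hpair : Measurable fun ω : K × (P × L → Γ) => (ω.1, pads ω.2) :=
    measurable_fst.prodMk (hpads.comp measurable_snd)
  have hadd := B.measurePreserving_add_mask μ A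
  rw [hshare]
  refine indepFun_of_identDistrib_pair
    (indepFun_prod (μ := μ) (ν := uniformFamily (P × L) Γ) measurable_id hpads)
    ⟨hpair.aemeasurable, (hpair.comp hadd.measurable).aemeasurable, ?_⟩
  conv_lhs => rw [← hadd.map_eq]
  exact Measure.map_map hpair hadd.measurable

variable [Finite P] [Fintype K] [Nontrivial K]

omit [Countable K] in
theorem shannonEntropy_secret {Ω : Type} [MeasurableSpace Ω] (ν : Measure Ω)
    [IsProbabilityMeasure ν] :
    shannonEntropy ((uniformOn (Set.univ : Set K)).prod ν) Prod.fst =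
      ENNReal.ofReal (Real.log (Fintype.card K)) := by
  refine shannonEntropy_of_uniform fun s => ?_
  rw [probMass, ← Set.prod_univ, measureReal_def, Measure.prod_prod, measure_univ, mul_one,
    uniformOn_univ, Measure.count_singleton, one_div, ENNReal.toReal_inv, ENNReal.toReal_natCast]

/-- The scheme in which each part of the secret is distributed, with a fresh one-time pad, on each
biclique of the corresponding partition. -/
noncomputable def scheme : SecretSharingScheme G where
  Ω := K × (P × L → Γ)
  μ := (uniformOn Set.univ).prod (uniformFamily _ Γ)
  Secret := K
  Share _ := P → Γ
  secret := Prod.fst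
  share := B.share
  measurable_secret := measurable_fst
  measurable_share := B.measurable_share
  entropy_secret_pos := by
    rw [shannonEntropy_secret, ENNReal.ofReal_pos]
    exact Real.log_pos (by exact_mod_cast Fintype.one_lt_card)
  entropy_secret_lt_top := by
    rw [shannonEntropy_secret]
    exact ENNReal.ofReal_lt_top
  recover _ _ hvw := (B.exists_recover hvw).imp fun _ hg => ae_of_all _ hg
  perfect _ hA := B.indepFun_secret_share _ hA

end BicliqueSystem

theorem BicliqueSystem.informationRatio_le {V P L K Γ : Type} {G : SimpleGraph V} [Fintype P]
    [Fintype K] [Nontrivial K] [AddGroup Γ] [Fintype Γ] (B : BicliqueSystem G P L K Γ) :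
    informationRatio G ≤ ENNReal.ofReal (Fintype.card P * Real.log (Fintype.card Γ)) /
      ENNReal.ofReal (Real.log (Fintype.card K)) := by
  classical
  let _ : MeasurableSpace K := ⊤
  let _ : MeasurableSpace Γ := ⊤
  refine (iInf_le _ B.scheme).trans (iSup_le fun v => ENNReal.div_le_div ?_ ?_)
  · rw [← Real.log_pow, ← Nat.cast_pow, ← Fintype.card_fun]
    exact shannonEntropy_le_log_card (T := P → Γ) (B.measurable_share v)
  · exact (shannonEntropy_secret (K := K) _).ge

end Biclique

section Squares

variable {d : ℕ}

/-- Ordered pairs of distinct directions. The two orders of a pair stand for the two chessboard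
classes of unit squares in the planes of these directions. -/
abbrev SquareClass (d : ℕ) : Type := {p : Fin d × Fin d // p.1 ≠ p.2}

namespace SquareClass

theorem card (d : ℕ) : Fintype.card (SquareClass d) = d * (d - 1) := by
  have hcard := Finset.offDiag_card (Finset.univ : Finset (Fin d))
  rw [Finset.card_univ, Fintype.card_fin, ← Nat.mul_sub_one] at hcard
  rw [← hcard, Fintype.card_subtype]
  congr 1
  ext p
  simp

/-- The offset which distinguishes the two chessboard classes of the same planes. -/
def offset (p : SquareClass d) : ℤ := if p.1.1 < p.1.2 then 0 else 1

/-- A label of the unit square of the class `p` which contains the point `v`. -/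
def square (p : SquareClass d) (v : Fin d → ℤ) (l : Fin d) : ℤ :=
  if l = p.1.1 ∨ l = p.1.2 then (v l + p.offset) / 2 else v l

theorem square_eq_square_of_eq {p : SquareClass d} {v w : Fin d → ℤ} {i : Fin d}
    (hne : ∀ l, l ≠ i → v l = w l) (hp : i = p.1.1 ∨ i = p.1.2)
    (hi : (v i + p.offset) / 2 = (w i + p.offset) / 2) : p.square v = p.square w := by
  funext l
  rcases eq_or_ne l i with rfl | hl
  · rw [square, square, if_pos hp, if_pos hp, hi]
  · rw [square, square, hne l hl]

theorem exists_offset_eq {i j : Fin d} (hij : i ≠ j) {e : ℤ} (he : e = 0 ∨ e = 1) :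
    ∃ p : SquareClass d, (p.1 = (i, j) ∨ p.1 = (j, i)) ∧ p.offset = e := by
  rcases lt_or_gt_of_ne hij with hlt | hlt <;> rcases he with rfl | rfl
  · exact ⟨⟨(i, j), hij⟩, Or.inl rfl, if_pos hlt⟩
  · exact ⟨⟨(j, i), hij.symm⟩, Or.inr rfl, if_neg hlt.not_gt⟩
  · exact ⟨⟨(j, i), hij.symm⟩, Or.inr rfl, if_pos hlt⟩
  · exact ⟨⟨(i, j), hij⟩, Or.inl rfl, if_neg hlt.not_gt⟩

theorem exists_square_eq {v w : Fin d → ℤ} {i j : Fin d} (hi : |v i - w i| = 1)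
    (hne : ∀ l, l ≠ i → v l = w l) (hij : i ≠ j) :
    ∃ p : SquareClass d, (p.1 = (i, j) ∨ p.1 = (j, i)) ∧ p.square v = p.square w := by
  obtain ⟨e, he, hdiv⟩ : ∃ e : ℤ, (e = 0 ∨ e = 1) ∧ (v i + e) / 2 = (w i + e) / 2 := by
    by_cases h : v i / 2 = w i / 2
    · exact ⟨0, Or.inl rfl, by omega⟩
    · rw [abs_eq zero_le_one] at hi
      exact ⟨1, Or.inr rfl, by omega⟩
  obtain ⟨p, hp, rfl⟩ := exists_offset_eq hij he
  refine ⟨p, hp, square_eq_square_of_eq hne ?_ hdiv⟩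
  rcases hp with hp | hp <;> simp [hp]

theorem even_sum_iff_of_square_eq {p : SquareClass d} {v w : Fin d → ℤ}
    (heq : p.square v = p.square w) (hvw : ¬ (latticeGraph d).Adj v w) :
    Even (∑ l, v l) ↔ Even (∑ l, w l) := by
  obtain ⟨⟨i, j⟩, hij⟩ := p
  have hne : ∀ l, l ≠ i → l ≠ j → v l = w l := fun l hi hj => by
    simpa [square, hi, hj] using congrFun heq l
  have hi : (v i + offset ⟨(i, j), hij⟩) / 2 = (w i + offset ⟨(i, j), hij⟩) / 2 := by
    simpa [square] using congrFun heq i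
  have hj : (v j + offset ⟨(i, j), hij⟩) / 2 = (w j + offset ⟨(i, j), hij⟩) / 2 := by
    simpa [square] using congrFun heq j
  have hsum : ∑ l, v l - ∑ l, w l = (v i - w i) + (v j - w j) := by
    rw [← Finset.sum_sub_distrib]
    exact Finset.sum_eq_add i j hij (fun l _ hl => sub_eq_zero.2 (hne l hl.1 hl.2))
      (fun h => absurd (Finset.mem_univ _) h) (fun h => absurd (Finset.mem_univ _) h)
  have hside : ¬ (|v i - w i| = 1 ∧ v j = w j) := fun h => hvw ⟨i, h.1, fun l hl =>
    (eq_or_ne l j).elim (fun hlj => hlj ▸ h.2) (hne l hl)⟩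
  have hside' : ¬ (|v j - w j| = 1 ∧ v i = w i) := fun h => hvw ⟨j, h.1, fun l hl =>
    (eq_or_ne l i).elim (fun hli => hli ▸ h.2) fun hli => hne l hli hl⟩
  rw [← Int.even_sub, hsum]
  rw [abs_eq zero_le_one] at hside hside'
  grind

end SquareClass

/-- The unit squares of the lattice as bicliques. The secret is a family of bits, one for each
direction, the first one being zero; the part distributed on the squares in a plane is the sum of
the bits of its two directions. -/
def squareSystem (n : ℕ) : BicliqueSystem (latticeGraph (n + 1)) (SquareClass (n + 1))
    (Fin (n + 1) → ℤ) (Fin n → ZMod 2) (ZMod 2) where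
  color := latticeColoring (n + 1)
  block := SquareClass.square
  part p s :=
    let t : Fin (n + 1) → ZMod 2 := Fin.cons 0 s
    t p.1.1 + t p.1.2
  color_eq_of_not_adj heq hvw := decide_eq_decide.2 (SquareClass.even_sum_iff_of_square_eq heq hvw)
  eq_of_part_eq := by
    rintro v w s s' ⟨i, hi, hne⟩ hpart
    set t : Fin (n + 1) → ZMod 2 := Fin.cons 0 s with ht
    set t' : Fin (n + 1) → ZMod 2 := Fin.cons 0 s' with ht'
    have hadd : ∀ j, t i + t j = t' i + t' j := by
      intro j
      rcases eq_or_ne i j with rfl | hij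
      · rw [CharTwo.add_self_eq_zero, CharTwo.add_self_eq_zero]
      obtain ⟨p, hp, hsquare⟩ := SquareClass.exists_square_eq hi hne hij
      rcases hp with hp | hp
      · simpa [hp] using hpart p hsquare
      · simpa [hp, add_comm] using hpart p hsquare
    have hti : t i = t' i := by simpa [ht, ht'] using hadd 0
    have htt' : t = t' := funext fun j => by simpa [hti] using hadd j
    exact Fin.cons_right_injective 0 htt'

theorem informationRatio_latticeGraph_le {d : ℕ} (hd : 2 ≤ d) :
    informationRatio (latticeGraph d) ≤ d := by
  obtain ⟨n, rfl⟩ : ∃ n, d = n + 1 := ⟨d - 1, by omega⟩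
  have : NeZero n := ⟨by omega⟩
  refine (squareSystem n).informationRatio_le.trans (ENNReal.div_le_of_le_mul ?_)
  rw [SquareClass.card, Fintype.card_fun, ZMod.card, Fintype.card_fin, Nat.add_sub_cancel,
    ← ENNReal.ofReal_natCast, ← ENNReal.ofReal_mul (Nat.cast_nonneg _), Nat.cast_pow, Real.log_pow,
    Nat.cast_mul, mul_assoc]

end Squares

section Restriction

variable {V : Type} {G : SimpleGraph V}

/-- The restriction of a scheme to a spanned subgraph. -/
def SecretSharingScheme.restrict (S : SecretSharingScheme G) (W : Set V) :
    SecretSharingScheme (G.induce W) where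
  Ω := S.Ω
  μ := S.μ
  Secret := S.Secret
  Share v := S.Share v
  secret := S.secret
  share v := S.share v
  measurable_secret := S.measurable_secret
  measurable_share v := S.measurable_share v
  entropy_secret_pos := S.entropy_secret_pos
  entropy_secret_lt_top := S.entropy_secret_lt_top
  recover v w hvw := S.recover v w hvw
  perfect A hA := by
    have hind : G.IsIndepSet (Subtype.val '' A) := by
      rintro _ ⟨v, hv, rfl⟩ _ ⟨w, hw, rfl⟩ hne hvw
      exact hA hv hw (ne_of_apply_ne _ hne) hvw
    have hproj : Measurable fun (x : (v : (Subtype.val '' A : Set V)) → S.Share v) (v : A) =>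
        x ⟨v.1.1, ⟨v.1, v.2, rfl⟩⟩ :=
      measurable_pi_lambda _ fun v => measurable_pi_apply _
    exact (S.perfect _ hind).comp measurable_id hproj

theorem SecretSharingScheme.averageRatio_le_worstRatio [Fintype V] (S : SecretSharingScheme G) :
    S.averageRatio ≤ S.worstRatio := by
  refine ENNReal.div_le_of_le_mul ?_
  rw [mul_comm, ← nsmul_eq_mul, ← Finset.card_univ]
  exact Finset.sum_le_card_nsmul _ _ _ fun v _ => le_iSup S.ratio v

theorem spannedAverageRatio_le_informationRatio (G : SimpleGraph V) (W : Finset V) :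
    spannedAverageRatio G W ≤ informationRatio G :=
  le_iInf fun S => (iInf_le _ (S.restrict W)).trans <|
    (S.restrict W).averageRatio_le_worstRatio.trans <| iSup_le fun v => le_iSup S.ratio v.1

theorem localAverageInformationRatio_le_informationRatio (G : SimpleGraph V) :
    localAverageInformationRatio G ≤ informationRatio G :=
  iSup₂_le fun W _ => spannedAverageRatio_le_informationRatio G W

end Restriction

theorem theorem2 (d : ℕ) (hd : 2 ≤ d) :
    informationRatio (latticeGraph d) = (d : ℝ≥0∞) ∧
    localAverageInformationRatio (latticeGraph d) = (d : ℝ≥0∞) ∧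
    Tendsto (fun k : ℕ => spannedAverageRatio (latticeGraph d) (latticeBox d k))
      atTop (𝓝 (d : ℝ≥0∞)) := by
  have : NeZero d := ⟨by omega⟩
  have hle : informationRatio (latticeGraph d) ≤ d := informationRatio_latticeGraph_le hd
  have hlocal := localAverageInformationRatio_le_informationRatio (latticeGraph d)
  have hlim : Tendsto (fun k : ℕ => spannedAverageRatio (latticeGraph d) (latticeBox d k))
      atTop (𝓝 (d : ℝ≥0∞)) :=
    tendsto_of_tendsto_of_tendsto_of_le_of_le (tendsto_mul_sub_two_pow_div_pow d)
      tendsto_const_nhds (fun k => le_spannedAverageRatio_latticeBox d k)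
      fun k => (spannedAverageRatio_le_informationRatio _ _).trans hle
  have hge : (d : ℝ≥0∞) ≤ localAverageInformationRatio (latticeGraph d) := by
    refine le_of_tendsto hlim ((eventually_gt_atTop 0).mono fun k hk => ?_)
    have hbox : (latticeBox d k).Nonempty :=
      Finset.card_pos.1 ((card_latticeBox d k).symm ▸ pow_pos hk d)
    exact le_iSup₂ (f := fun (W : Finset _) (_ : W.Nonempty) => spannedAverageRatio _ W) _ hbox
  exact ⟨le_antisymm hle (hge.trans hlocal), le_antisymm (hlocal.trans hle) hge, hlim⟩
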